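/- Let $m=(m_0,m_1,\dots)$ be a sequence of integers $m_k\ge 2$, let $G_m=\prod_{k\ge 0} Z_{m_k}$ with $Z_{m_k}=\{0,\dots,m_k-1\}$ the cyclic group of order $m_k$, and let $\mu$ be the normalized Haar measure of $G_m$ (the product of the uniform measures on the $Z_{m_k}$). Put $M_0=1$, $M_{k+1}=m_kM_k$, write each $n\in\mathbb N=\{0,1,\dots\}$ as $n=\sum_j n_jM_j$ with $0\le n_j<m_j$, and let $\psi_n(x)=\prod_k \exp(2\pi i x_k/m_k)^{n_k}$ be the Vilenkin functions on $G_m$. Let $\mathcal F_n$ be the $\sigma$-algebra generated by the sets $I_n(x)=\{y\in G_m: y_0=x_0,\dots,y_{n-1}=x_{n-1}\}$, $x\in G_m$. For $0<p<1$ the Hardy space $H_p(G_m)$ consists of the complex martingales $f=(f_n)_{n\ge0}$ with respect to $(\mathcal F_n)$ for which $\|f\|_{H_p}:=\|\sup_n|f_n|\|_p<\infty$. For a martingale $f$ let $\widehat f(i)=\lim_{k\to\infty}\int f_k\overline{\psi_i}\,d\mu$, $S_kf=\sum_{i<k}\widehat f(i)\psi_i$, and $\omega(1/M_n,f)_{H_p}=\|f-S_{M_n}f\|_{H_p}$,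 where $f-S_{M_n}f$ is the martingale $(f_k-S_{M_n}f_k)_{k\ge0}$. Let $\|g\|_{L_{p,\infty}}=\sup_{t>0}t\,\mu(|g|>t)^{1/p}$, and let $L_{p,\infty}(G_m)$ be the space of measurable functions $g:G_m\to\mathbb C$ with $\|g\|_{L_{p,\infty}}<\infty$. Where a martingale $f$ is compared with functions in $L_{p,\infty}$, it stands for its almost everywhere limit $f_\infty=\lim_n f_n$; that this limit exists almost everywhere and lies in $L_{p,\infty}(G_m)$ is part of the claims below. Theorem 3. Let $0<p<1$. (a) Suppose that the sequence $m$ is bounded, that $f\in H_p(G_m)$, and that $$\omega\left(\tfrac1{M_n},f\right)_{H_p}=o\left(\frac1{M_n^{1/p-1}}\right)\quad\text{as } n\to\infty .$$ Then $\|S_kf-f\|_{L_{p,\infty}}\to0$ as $k\to\infty$. (b) For every sequence $m$ as above there is a martingale $f\in H_p(G_m)$ with $$\omega\left(\tfrac1{M_{2n}},f\right)_{H_p}=O\left(\frac1{M_{2n}^{1/p-1}}\right)\quad\text{as } n\to\infty$$ for which $\|S_kf-f\|_{L_{p,\infty}}\not\to0$ as $k\to\infty$. -/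

import Mathlib

open MeasureTheory Filter Topology
open scoped ENNReal NNReal ComplexConjugate

namespace Vilenkin

/-- The Vilenkin group `G_m`: the complete direct product of the cyclic groups `Z_{m_k}`. -/
abbrev Gm (m : ℕ → ℕ) : Type := (k : ℕ) → ZMod (m k)

/-- The measure on `Z_{m_k}` that gives mass `1 / m_k` to every point. -/
noncomputable def coordMeasure (m : ℕ → ℕ) (k : ℕ) : Measure (ZMod (m k)) :=
  ((m k : ℝ≥0∞)⁻¹) • Measure.count

/-- The normalized Haar measure on `G_m`, the product of the measures on the coordinates. -/
noncomputable def haar (m : ℕ → ℕ) : Measure (Gm m) :=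
  Measure.infinitePi (coordMeasure m)

/-- The generalized powers `M_0 = 1`, `M_{k+1} = m_k M_k`. -/
def M (m : ℕ → ℕ) (n : ℕ) : ℕ := ∏ k ∈ Finset.range n, m k

/-- The interval `I_n(x)` of the points that agree with `x` in the coordinates `0, …, n-1`. -/
def interval (m : ℕ → ℕ) (n : ℕ) (x : Gm m) : Set (Gm m) := {y | ∀ i < n, y i = x i}

theorem measurableSet_interval (m : ℕ → ℕ) (n : ℕ) (x : Gm m) :
    MeasurableSet (interval m n x) := by
  have h : interval m n x = ⋂ i : ℕ, ⋂ _ : i < n, (fun y : Gm m => y i) ⁻¹' {x i} := by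
    ext y
    simp [interval]
  rw [h]
  refine MeasurableSet.iInter fun i => MeasurableSet.iInter fun _ => ?_
  exact measurable_pi_apply i (MeasurableSet.singleton _)

theorem interval_eq_iUnion (m : ℕ → ℕ) (n : ℕ) (x : Gm m) :
    interval m n x = ⋃ a : ZMod (m n), interval m (n + 1) (Function.update x n a) := by
  ext y
  simp only [interval, Set.mem_ofPred_eq, Set.mem_iUnion]
  constructor
  · intro h
    refine ⟨y n, fun i hi => ?_⟩
    rcases eq_or_ne i n with rfl | hne
    · simp
    · rw [Function.update_of_ne hne]
      exact h i (by omega)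
  · rintro ⟨a, h⟩ i hi
    have := h i (by omega)
    rwa [Function.update_of_ne (by omega)] at this

/-- The filtration `(F_n)`: `F_n` is the `σ`-algebra generated by the intervals `I_n(x)`. -/
def filtration (m : ℕ → ℕ) : Filtration ℕ (inferInstance : MeasurableSpace (Gm m)) where
  seq n := MeasurableSpace.generateFrom {s | ∃ x : Gm m, s = interval m n x}
  mono' := by
    refine monotone_nat_of_le_succ fun n => ?_
    refine MeasurableSpace.generateFrom_le ?_
    rintro s ⟨x, rfl⟩
    rw [interval_eq_iUnion]
    have : Countable (ZMod (m n)) := by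
      rcases m n with _ | k
      · exact inferInstanceAs (Countable ℤ)
      · exact inferInstanceAs (Countable (Fin (k + 1)))
    exact MeasurableSet.iUnion fun a => MeasurableSpace.measurableSet_generateFrom ⟨_, rfl⟩
  le' n := by
    refine MeasurableSpace.generateFrom_le ?_
    rintro s ⟨x, rfl⟩
    exact measurableSet_interval m n x

/-- The digit `n_j` of `n` in the number system based on `m`: `n = ∑ n_j M_j`,
`0 ≤ n_j < m_j`. -/
def digit (m : ℕ → ℕ) (n j : ℕ) : ℕ := n / M m j % m j

/-- The generalized Rademacher functions `r_k(x) = exp (2 π i x_k / m_k)`. -/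
noncomputable def rademacher (m : ℕ → ℕ) (k : ℕ) (x : Gm m) : ℂ :=
  Complex.exp (2 * Real.pi * Complex.I * ((x k).val : ℂ) / (m k : ℂ))

/-- The Vilenkin functions `ψ_n = ∏_k r_k ^ {n_k}`; all but finitely many factors are `1`. -/
noncomputable def psi (m : ℕ → ℕ) (n : ℕ) (x : Gm m) : ℂ :=
  ∏ᶠ k : ℕ, rademacher m k x ^ digit m n k

/-- The Vilenkin-Fourier coefficients of an integrable function. -/
noncomputable def fourierCoeff (m : ℕ → ℕ) (g : Gm m → ℂ) (i : ℕ) : ℂ :=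
  ∫ x, g x * conj (psi m i x) ∂(haar m)

/-- The partial sums `S_n g = ∑_{k<n} ĝ(k) ψ_k` of an integrable function. -/
noncomputable def partialSum (m : ℕ → ℕ) (g : Gm m → ℂ) (n : ℕ) (x : Gm m) : ℂ :=
  ∑ k ∈ Finset.range n, fourierCoeff m g k * psi m k x

/-- The Vilenkin-Fourier coefficients of a martingale, `lim_k ∫ f_k conj(ψ_i)`
(the sequence is eventually constant for every martingale). -/
noncomputable def martCoeff (m : ℕ → ℕ) (f : ℕ → Gm m → ℂ) (i : ℕ) : ℂ :=
  limUnder atTop (fun k => fourierCoeff m (f k) i)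

/-- The partial sums `S_n f = ∑_{k<n} f̂(k) ψ_k` of the Vilenkin-Fourier series of a
martingale. -/
noncomputable def martPartialSum (m : ℕ → ℕ) (f : ℕ → Gm m → ℂ) (n : ℕ) (x : Gm m) : ℂ :=
  ∑ k ∈ Finset.range n, martCoeff m f k * psi m k x

/-- The maximal function `f^* = sup_n |f_n|`. -/
noncomputable def maximalFunction {m : ℕ → ℕ} (f : ℕ → Gm m → ℂ) (x : Gm m) : ℝ≥0∞ :=
  ⨆ n, ‖f n x‖ₑ

/-- The `H_p` (quasi-)norm `‖f‖_{H_p} = ‖f^*‖_p`, with values in `[0, ∞]`. -/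
noncomputable def hpNorm (m : ℕ → ℕ) (p : ℝ) (f : ℕ → Gm m → ℂ) : ℝ≥0∞ :=
  (∫⁻ x, maximalFunction f x ^ p ∂(haar m)) ^ (1 / p)

/-- Membership in the martingale Hardy space `H_p(G_m)`. -/
def MemHp (m : ℕ → ℕ) (p : ℝ) (f : ℕ → Gm m → ℂ) : Prop :=
  Martingale f (filtration m) (haar m) ∧ hpNorm m p f < ∞

/-- The modulus of continuity `ω(1/M_n, f)_{H_p} = ‖f - S_{M_n} f‖_{H_p}`, where
`f - S_{M_n} f` is the martingale `(f_k - S_{M_n} f_k)_k`. -/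
noncomputable def modulus (m : ℕ → ℕ) (p : ℝ) (f : ℕ → Gm m → ℂ) (n : ℕ) : ℝ≥0∞ :=
  hpNorm m p (fun k x => f k x - partialSum m (f k) (M m n) x)

/-- The weak-`L_p` (quasi-)norm `sup_{t>0} t μ(|g| > t)^{1/p}`, with values in `[0, ∞]`. -/
noncomputable def weakLpNorm (m : ℕ → ℕ) (p : ℝ) (g : Gm m → ℂ) : ℝ≥0∞ :=
  ⨆ (t : ℝ≥0) (_ : 0 < t), (t : ℝ≥0∞) * haar m {x | (t : ℝ≥0∞) < ‖g x‖ₑ} ^ (1 / p)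

/-- Membership in the space `L_{p,∞}(G_m)`. -/
def MemWeakLp (m : ℕ → ℕ) (p : ℝ) (g : Gm m → ℂ) : Prop :=
  Measurable g ∧ weakLpNorm m p g < ∞

/-- The function `F` is the almost everywhere limit of the martingale `f`. -/
def IsLimitFunction (m : ℕ → ℕ) (f : ℕ → Gm m → ℂ) (F : Gm m → ℂ) : Prop :=
  ∀ᵐ x ∂(haar m), Tendsto (fun n => f n x) atTop (𝓝 (F x))

end Vilenkin

/-! For (a), the operator `S_{M_n}` is averaging over intervals, so `S_{M_n} f = f_n` and the
modulus controls the tail of the martingale. If `M_n ≤ k ≤ M_{n+1}`, then `S_k f - f_n = S_k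
(f_{n+1} - f_n)` (`martPartialSum_sub_eq`), where the difference is constant on intervals of measure
`1 / M_{n+1}`. On such functions `S_k` is bounded in `L_p` with norm `O(M_{n+1}^{1/p-1})`
(`lintegral_partialSum_le`). This rests on two facts. The kernel is at most `M_{s+1}` when `x` and
`t` first differ in coordinate `s`, so for bounded `m` and `p < 1` its `L_p` norms are uniformly
bounded (`lintegral_kernel_le`). For a function constant on these intervals, the `p`-th power of the
integral is at most `M_{n+1}^{1-p}` times the integral of the `p`-th power
(`lintegral_rpow_interval_invariant_le`). Hence the error is `O(M_n^{1/p-1} ω(1/M_n, f))`, even in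
`L_p`, and Chebyshev passes to the weak norm.

For (b), take `f = ∑_j r_j D_{M_j}`. The `j`-th term has modulus `M_j` on `I_j(0)` and vanishes
elsewhere, so its `p`-th power has integral `M_j^{p-1}`; summing the tail gives the required order
of the modulus. But the coefficient at every `M_n` is `1`, so consecutive partial sums differ by a
unimodular function infinitely often, which excludes even convergence in measure. -/

namespace Vilenkin

/-! ### Digits in the mixed-radix number system -/

section Arithmetic

variable {m : ℕ → ℕ}

theorem M_zero : M m 0 = 1 := by simp [M]

theorem M_succ (n : ℕ) : M m (n + 1) = M m n * m n := Finset.prod_range_succ _ _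

theorem M_pos [∀ k, NeZero (m k)] (n : ℕ) : 0 < M m n :=
  Finset.prod_pos fun k _ => Nat.pos_of_ne_zero (NeZero.ne (m k))

theorem M_dvd {k n : ℕ} (h : k ≤ n) : M m k ∣ M m n :=
  Finset.prod_dvd_prod_of_subset _ _ _ (Finset.range_mono h)

theorem M_mono [∀ k, NeZero (m k)] : Monotone (M m) :=
  fun _ _ h => Nat.le_of_dvd (M_pos _) (M_dvd h)

theorem two_pow_le_M (hm : ∀ k, 2 ≤ m k) (n : ℕ) : 2 ^ n ≤ M m n := by
  induction n with
  | zero => simp [M]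
  | succ n ih => rw [pow_succ, M_succ]; exact Nat.mul_le_mul ih (hm n)

theorem two_mul_M_le (hm : ∀ k, 2 ≤ m k) (n : ℕ) : 2 * M m n ≤ M m (n + 1) := by
  rw [M_succ, mul_comm]; exact Nat.mul_le_mul_left _ (hm n)

/-- This form makes visible that the digit depends only on the residue of `n` modulo `M_{j+1}`. -/
theorem digit_eq_mod_div (n j : ℕ) : digit m n j = n % M m (j + 1) / M m j := by
  rw [M_succ, Nat.mod_mul_right_div_self, digit]

theorem digit_eq_zero [∀ k, NeZero (m k)] {i n k : ℕ} (hi : i < M m n) (hk : n ≤ k) :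
    digit m i k = 0 := by
  rw [digit, Nat.div_eq_of_lt (hi.trans_le (M_mono hk)), Nat.zero_mod]

theorem digit_mul_add_of_lt {n k : ℕ} (hk : k < n) (q j : ℕ) :
    digit m (q * M m n + j) k = digit m j k := by
  obtain ⟨c, hc⟩ := M_dvd (m := m) (Nat.succ_le_of_lt hk)
  rw [digit_eq_mod_div, digit_eq_mod_div, hc, Nat.succ_eq_add_one,
    show q * (M m (k + 1) * c) + j = j + M m (k + 1) * (q * c) by ring, Nat.add_mul_mod_self_left]

theorem digit_mul_add_of_le [∀ k, NeZero (m k)] {n k : ℕ} (hk : n ≤ k) (q : ℕ) {j : ℕ}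
    (hj : j < M m n) : digit m (q * M m n + j) k = digit m (q * M m n) k := by
  obtain ⟨c, hc⟩ := M_dvd (m := m) hk
  rw [digit, digit, hc, ← Nat.div_div_eq_div_mul, ← Nat.div_div_eq_div_mul, mul_comm q,
    Nat.mul_add_div (M_pos n), Nat.div_eq_of_lt hj, Nat.mul_div_cancel_left _ (M_pos n), add_zero]

theorem digit_mul_M [∀ k, NeZero (m k)] {n a : ℕ} (ha : a < m n) (k : ℕ) :
    digit m (a * M m n) k = if k = n then a else 0 := by
  split_ifs with h
  · subst h
    rw [digit, Nat.mul_div_cancel _ (M_pos k), Nat.mod_eq_of_lt ha]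
  · rcases lt_or_gt_of_ne h with h | h
    · have := digit_mul_add_of_lt (m := m) h a 0
      rw [add_zero] at this
      rw [this]; simp [digit]
    · refine digit_eq_zero (n := n + 1) ?_ h
      rw [M_succ, mul_comm]
      exact Nat.mul_lt_mul_of_pos_left ha (M_pos n)

theorem norm_rademacher (k : ℕ) (x : Gm m) : ‖rademacher m k x‖ = 1 := by
  rw [rademacher, show (2 * Real.pi * Complex.I * ((x k).val : ℂ) / (m k : ℂ)) =
    ((2 * Real.pi * (x k).val / m k : ℝ) : ℂ) * Complex.I by push_cast; ring]
  exact Complex.norm_exp_ofReal_mul_I _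

theorem rademacher_eq_pow (k : ℕ) (x : Gm m) :
    rademacher m k x = Complex.exp (2 * Real.pi * Complex.I / m k) ^ (x k).val := by
  rw [rademacher, ← Complex.exp_nat_mul]
  congr 1
  ring

theorem exists_lt_M (hm : ∀ k, 2 ≤ m k) (i : ℕ) : ∃ n, i < M m n :=
  ⟨i, Nat.lt_two_pow_self.trans_le (two_pow_le_M hm i)⟩

end Arithmetic

/-! ### Multiplicative structure of the Vilenkin functions -/

section Characters

variable {m : ℕ → ℕ} [∀ k, NeZero (m k)]

theorem rademacher_pow (k : ℕ) (x : Gm m) : rademacher m k x ^ m k = 1 := by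
  have h : (m k : ℂ) ≠ 0 := Nat.cast_ne_zero.2 (NeZero.ne _)
  rw [rademacher, ← Complex.exp_nat_mul, mul_div_cancel₀ _ h]
  rw [show 2 * (Real.pi : ℂ) * Complex.I * ((x k).val : ℂ) =
    ((x k).val : ℂ) * (2 * Real.pi * Complex.I) by ring]
  exact Complex.exp_nat_mul_two_pi_mul_I _

theorem rademacher_inj {k : ℕ} {x t : Gm m} (h : rademacher m k x = rademacher m k t) :
    x k = t k := by
  rw [rademacher_eq_pow, rademacher_eq_pow] at h
  exact ZMod.val_injective _ ((Complex.isPrimitiveRoot_exp (m k) (NeZero.ne _)).pow_inj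
    (ZMod.val_lt _) (ZMod.val_lt _) h)

theorem psi_eq_prod {i n : ℕ} (hi : i < M m n) (x : Gm m) :
    psi m i x = ∏ k ∈ Finset.range n, rademacher m k x ^ digit m i k := by
  refine finprod_eq_prod_of_mulSupport_subset _ fun k hk => ?_
  by_contra h
  simp only [Finset.coe_range, Set.mem_Iio, not_lt] at h
  exact hk (by simp [digit_eq_zero hi h])

theorem norm_psi_of_lt {i n : ℕ} (hi : i < M m n) (x : Gm m) : ‖psi m i x‖ = 1 := by
  rw [psi_eq_prod hi, norm_prod]
  exact Finset.prod_eq_one fun k _ => by simp [norm_rademacher]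

/-- The digits of `q * M_n` sit at places `≥ n` and those of `j` at places `< n`, so the addition
has no carries. -/
theorem psi_mul_add {q n j N : ℕ} (hj : j < M m n) (hN : q * M m n + j < M m N) (x : Gm m) :
    psi m (q * M m n + j) x = psi m (q * M m n) x * psi m j x := by
  rw [psi_eq_prod hN, psi_eq_prod (i := q * M m n) (n := N) (by omega),
    psi_eq_prod (i := j) (n := N) (by omega), ← Finset.prod_mul_distrib]
  refine Finset.prod_congr rfl fun k _ => ?_
  rw [← pow_add]
  congr 1
  rcases lt_or_ge k n with h | h
  · rw [digit_mul_add_of_lt h]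
    have := digit_mul_add_of_lt (m := m) h q 0
    rw [add_zero] at this
    rw [this]; simp [digit]
  · rw [digit_mul_add_of_le h q hj, digit_eq_zero hj h, add_zero]

theorem psi_mul_M {n a : ℕ} (ha : a < m n) (x : Gm m) :
    psi m (a * M m n) x = rademacher m n x ^ a := by
  rw [psi_eq_prod (n := n + 1)]
  · simp [digit_mul_M ha, pow_ite]
  · rw [M_succ, mul_comm]
    exact Nat.mul_lt_mul_of_pos_left ha (M_pos n)

theorem psi_congr {i n : ℕ} (hi : i < M m n) {x y : Gm m} (h : y ∈ interval m n x) :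
    psi m i y = psi m i x := by
  rw [psi_eq_prod hi, psi_eq_prod hi]
  refine Finset.prod_congr rfl fun k hk => ?_
  rw [rademacher, rademacher, h k (Finset.mem_range.1 hk)]

end Characters

/-- The kernel `∑_{i<k} ψ_i(x) conj ψ_i(t) = D_k(x - t)` of the partial sum operator `S_k`. -/
noncomputable def kernel (m : ℕ → ℕ) (k : ℕ) (x t : Gm m) : ℂ :=
  ∑ i ∈ Finset.range k, psi m i x * conj (psi m i t)

/-! ### Dirichlet kernels and their pointwise bounds -/

section Kernel

variable {m : ℕ → ℕ} [∀ k, NeZero (m k)]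

theorem norm_psi (hm : ∀ k, 2 ≤ m k) (i : ℕ) (x : Gm m) : ‖psi m i x‖ = 1 := by
  obtain ⟨n, hn⟩ := exists_lt_M hm i
  exact norm_psi_of_lt hn x

theorem norm_kernel_le (hm : ∀ k, 2 ≤ m k) (k : ℕ) (x t : Gm m) : ‖kernel m k x t‖ ≤ k := by
  refine (norm_sum_le _ _).trans ?_
  simp [norm_psi hm]

theorem kernel_mul_add (hm : ∀ k, 2 ≤ m k) (q n : ℕ) {j : ℕ} (hj : j ≤ M m n) (x t : Gm m) :
    kernel m (q * M m n + j) x t = kernel m (q * M m n) x t +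
      psi m (q * M m n) x * conj (psi m (q * M m n) t) * kernel m j x t := by
  rw [kernel, Finset.sum_range_add]
  congr 1
  rw [kernel, Finset.mul_sum]
  refine Finset.sum_congr rfl fun i hi => ?_
  have hi : i < M m n := (Finset.mem_range.1 hi).trans_le hj
  obtain ⟨N, hN⟩ := exists_lt_M hm (q * M m n + i)
  rw [psi_mul_add hi hN, psi_mul_add hi hN, map_mul]
  ring

theorem kernel_mul (hm : ∀ k, 2 ≤ m k) (q n : ℕ) (x t : Gm m) :
    kernel m (q * M m n) x t =
      (∑ a ∈ Finset.range q, psi m (a * M m n) x * conj (psi m (a * M m n) t)) *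
        kernel m (M m n) x t := by
  induction q with
  | zero => simp [kernel]
  | succ q ih => rw [add_mul, one_mul, kernel_mul_add hm q n le_rfl, ih, Finset.sum_range_succ,
      add_mul]

/-- A full geometric sum of an `m_n`-th root of unity other than `1`. -/
theorem sum_rademacher_eq_zero {n : ℕ} {x t : Gm m} (h : x n ≠ t n) :
    ∑ a ∈ Finset.range (m n), psi m (a * M m n) x * conj (psi m (a * M m n) t) = 0 := by
  set z := rademacher m n x * conj (rademacher m n t) with hz
  have h1 : ∑ a ∈ Finset.range (m n), psi m (a * M m n) x * conj (psi m (a * M m n) t) =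
      ∑ a ∈ Finset.range (m n), z ^ a := by
    refine Finset.sum_congr rfl fun a ha => ?_
    rw [psi_mul_M (Finset.mem_range.1 ha), psi_mul_M (Finset.mem_range.1 ha), map_pow, mul_pow]
  have h2 : z ≠ 1 := by
    intro h3
    refine h (rademacher_inj ?_)
    have h4 : conj (rademacher m n t) * rademacher m n t = 1 := by
      rw [mul_comm, Complex.mul_conj, Complex.normSq_eq_norm_sq, norm_rademacher]; simp
    calc rademacher m n x = z * rademacher m n t := by rw [hz, mul_assoc, h4, mul_one]
      _ = _ := by rw [h3, one_mul]
  have h5 : z ^ m n = 1 := by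
    rw [hz, mul_pow, ← map_pow, rademacher_pow, rademacher_pow]; simp
  rw [h1, geom_sum_eq h2, h5]
  simp

theorem kernel_M_eq_zero (hm : ∀ k, 2 ≤ m k) {n : ℕ} {x t : Gm m} (h : x ∉ interval m n t) :
    kernel m (M m n) x t = 0 := by
  induction n with
  | zero => exact absurd (by simp [interval]) h
  | succ n ih =>
    rw [M_succ, mul_comm, kernel_mul hm]
    by_cases h' : x ∈ interval m n t
    · rw [sum_rademacher_eq_zero, zero_mul]
      intro h2
      refine h fun i hi => ?_
      rcases Nat.lt_succ_iff_lt_or_eq.1 hi with h3 | rfl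
      exacts [h' i h3, h2]
    · rw [ih h', mul_zero]

theorem kernel_M_eq (hm : ∀ k, 2 ≤ m k) {n : ℕ} {x t : Gm m} (h : x ∈ interval m n t) :
    kernel m (M m n) x t = M m n := by
  have : ∀ i ∈ Finset.range (M m n), psi m i x * conj (psi m i t) = 1 := by
    intro i hi
    rw [psi_congr (Finset.mem_range.1 hi) h, Complex.mul_conj, Complex.normSq_eq_norm_sq,
      norm_psi hm]
    simp
  rw [kernel, Finset.sum_congr rfl this]
  simp

/-- Write `k = q * M_n + r` with `r < M_n`. The first `q * M_n` terms contain the factor `D_{M_n}`,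
which vanishes here, and the other `r` terms are unimodular. -/
theorem norm_kernel_le_of_notMem (hm : ∀ k, 2 ≤ m k) (k : ℕ) {n : ℕ} {x t : Gm m}
    (h : x ∉ interval m n t) : ‖kernel m k x t‖ ≤ M m n := by
  have h1 : k % M m n < M m n := Nat.mod_lt _ (M_pos n)
  rw [← Nat.div_add_mod' k (M m n), kernel_mul_add hm _ _ h1.le, kernel_mul hm,
    kernel_M_eq_zero hm h, mul_zero, zero_add, norm_mul, norm_mul, RCLike.norm_conj,
    norm_psi hm, norm_psi hm, one_mul, one_mul]
  exact (norm_kernel_le hm _ _ _).trans (Nat.cast_le.2 h1.le)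

/-- If `s` is the first coordinate in which `x` and `t` differ, the term with index `s` alone
dominates. On the diagonal the series diverges, so nothing is claimed there. -/
theorem enorm_kernel_rpow_le (hm : ∀ k, 2 ≤ m k) {p : ℝ} (hp : 0 < p) (k : ℕ) (x t : Gm m) :
    ‖kernel m k x t‖ₑ ^ p ≤
      ∑' s, (interval m s t).indicator (fun _ => (M m (s + 1) : ℝ≥0∞) ^ p) x := by
  classical
  by_cases h : ∃ s, x s ≠ t s
  · have h1 : x ∈ interval m (Nat.find h) t := fun i hi => not_not.1 (Nat.find_min h hi)
    have h2 : x ∉ interval m (Nat.find h + 1) t :=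
      fun h' => Nat.find_spec h (h' _ (Nat.lt_succ_self _))
    refine le_trans ?_ (ENNReal.le_tsum (Nat.find h))
    rw [Set.indicator_of_mem h1]
    gcongr
    rw [← ofReal_norm]
    refine (ENNReal.ofReal_le_ofReal (norm_kernel_le_of_notMem hm k h2)).trans ?_
    simp
  · push Not at h
    have : ∑' s, (interval m s t).indicator (fun _ => (M m (s + 1) : ℝ≥0∞) ^ p) x = ∞ := by
      rw [← top_le_iff, ← ENNReal.tsum_const_eq_top_of_ne_zero (α := ℕ) one_ne_zero]
      refine ENNReal.tsum_le_tsum fun s => ?_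
      rw [Set.indicator_of_mem (show x ∈ interval m s t from fun i _ => h i)]
      refine ENNReal.one_le_rpow ?_ hp
      exact_mod_cast M_pos (m := m) (s + 1)
    rw [this]
    exact le_top

end Kernel

/-! ### Haar measure of the intervals -/

section HaarMeasure

variable {m : ℕ → ℕ}

theorem coordMeasure_singleton (k : ℕ) (a : ZMod (m k)) :
    coordMeasure m k {a} = (m k : ℝ≥0∞)⁻¹ := by
  simp [coordMeasure]

variable [∀ k, NeZero (m k)]

instance isProbabilityMeasure_coordMeasure (k : ℕ) : IsProbabilityMeasure (coordMeasure m k) := by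
  constructor
  have h : (m k : ℝ≥0∞) ≠ 0 := Nat.cast_ne_zero.2 (NeZero.ne _)
  simp [coordMeasure, Measure.count_apply, ENNReal.inv_mul_cancel h]

instance isProbabilityMeasure_haar : IsProbabilityMeasure (haar m) := by
  unfold haar; infer_instance

theorem haar_interval (n : ℕ) (x : Gm m) : haar m (interval m n x) = (M m n : ℝ≥0∞)⁻¹ := by
  have h : interval m n x = Set.pi (Finset.range n : Set ℕ) fun k => {x k} := by
    ext y; simp [interval]
  rw [h, haar, Measure.infinitePi_pi _ fun _ _ => MeasurableSet.singleton _]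
  simp only [coordMeasure_singleton]
  induction n with
  | zero => simp [M]
  | succ n ih =>
    rw [Finset.prod_range_succ, ih, M_succ, Nat.cast_mul, ENNReal.mul_inv (by simp) (by simp)]
    -- The product description `h` depends on `n`, so it became a premise of the induction
    -- hypothesis and is checked here.
    ext y; simp [interval]

end HaarMeasure

/-! ### Measurability with respect to `F_n` as constancy on intervals -/

section Intervals

variable {m : ℕ → ℕ}

theorem mem_interval_self (n : ℕ) (x : Gm m) : x ∈ interval m n x := fun _ _ => rfl

theorem mem_interval_comm {n : ℕ} {x y : Gm m} : x ∈ interval m n y ↔ y ∈ interval m n x :=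
  ⟨fun h i hi => (h i hi).symm, fun h i hi => (h i hi).symm⟩

theorem interval_eq_of_mem {n : ℕ} {x y : Gm m} (h : y ∈ interval m n x) :
    interval m n y = interval m n x :=
  Set.ext fun _ => ⟨fun hz i hi => (hz i hi).trans (h i hi),
    fun hz i hi => (hz i hi).trans (h i hi).symm⟩

theorem measurableSet_filtration_interval (n : ℕ) (x : Gm m) :
    MeasurableSet[filtration m n] (interval m n x) :=
  MeasurableSpace.measurableSet_generateFrom ⟨x, rfl⟩

/-- The intervals of order `n` partition the group, and the property of not splitting any of them
survives complements and countable unions. -/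
theorem mem_iff_of_measurableSet_filtration {n : ℕ} {s : Set (Gm m)}
    (hs : MeasurableSet[filtration m n] s) {x y : Gm m} (h : y ∈ interval m n x) :
    y ∈ s ↔ x ∈ s := by
  refine MeasurableSpace.generateFrom_induction {s | ∃ x : Gm m, s = interval m n x}
    (fun s _ => y ∈ s ↔ x ∈ s) ?_ (by simp) ?_ ?_ s hs
  · rintro _ ⟨z, rfl⟩ _
    rw [mem_interval_comm, mem_interval_comm (x := x), interval_eq_of_mem h]
  · intro t _ ht
    simp [ht]
  · intro t _ ht
    simp [ht]

theorem eq_of_stronglyMeasurable_filtration {n : ℕ} {g : Gm m → ℂ}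
    (hg : StronglyMeasurable[filtration m n] g) {x y : Gm m} (h : y ∈ interval m n x) :
    g y = g x :=
  (mem_iff_of_measurableSet_filtration
    (hg.measurable (MeasurableSet.singleton (g x))) h).2 rfl

theorem countable_range_interval [∀ k, NeZero (m k)] (n : ℕ) :
    (Set.range (interval m n)).Countable := by
  have : Set.range (interval m n) ⊆ Set.range fun a : (i : Fin n) → ZMod (m i) =>
      {y : Gm m | ∀ i : Fin n, y i = a i} := by
    rintro _ ⟨x, rfl⟩
    refine ⟨fun i => x i, ?_⟩
    ext y
    exact ⟨fun h i hi => h ⟨i, hi⟩, fun h i => h i i.2⟩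
  exact (Set.countable_range _).mono this

theorem measurableSet_filtration_of_forall [∀ k, NeZero (m k)] {n : ℕ} {s : Set (Gm m)}
    (hs : ∀ x y, y ∈ interval m n x → x ∈ s → y ∈ s) : MeasurableSet[filtration m n] s := by
  have h : s = ⋃₀ {t | t ∈ Set.range (interval m n) ∧ t ⊆ s} := by
    ext x
    constructor
    · exact fun hx => ⟨_, ⟨⟨x, rfl⟩, fun y hy => hs x y hy hx⟩, mem_interval_self n x⟩
    · rintro ⟨t, ⟨_, ht⟩, hx⟩
      exact ht hx
  rw [h]
  refine MeasurableSet.sUnion ((countable_range_interval n).mono fun t ht => ht.1) ?_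
  rintro _ ⟨⟨x, rfl⟩, _⟩
  exact measurableSet_filtration_interval n x

theorem stronglyMeasurable_filtration_of_forall [∀ k, NeZero (m k)] {n : ℕ} {g : Gm m → ℂ}
    (hg : ∀ x y, y ∈ interval m n x → g y = g x) : StronglyMeasurable[filtration m n] g := by
  have : Measurable[filtration m n] g := fun s _ =>
    measurableSet_filtration_of_forall fun x y h hx => by
      rw [Set.mem_preimage, hg x y h]; exact hx
  exact this.stronglyMeasurable

end Intervals

/-! ### Fourier coefficients and partial sums of functions and martingales -/

section Fourier

variable {m : ℕ → ℕ}

theorem conj_fourierCoeff_psi (i j : ℕ) :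
    conj (fourierCoeff m (psi m i) j) = fourierCoeff m (psi m j) i := by
  rw [fourierCoeff, fourierCoeff, ← integral_conj]
  congr 1
  ext x
  simp [mul_comm]

theorem fourierCoeff_const_mul (c : ℂ) (g : Gm m → ℂ) (i : ℕ) :
    fourierCoeff m (fun x => c * g x) i = c * fourierCoeff m g i := by
  simp only [fourierCoeff, mul_assoc]
  exact integral_const_mul _ _

variable [∀ k, NeZero (m k)]

theorem stronglyMeasurable_filtration_psi {i n : ℕ} (hi : i < M m n) :
    StronglyMeasurable[filtration m n] (psi m i) :=
  stronglyMeasurable_filtration_of_forall fun _ _ h => psi_congr hi h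

theorem measurable_psi (hm : ∀ k, 2 ≤ m k) (i : ℕ) : Measurable (psi m i) := by
  obtain ⟨n, hn⟩ := exists_lt_M hm i
  exact ((stronglyMeasurable_filtration_psi hn).mono ((filtration m).le n)).measurable

theorem integrable_mul_conj_psi (hm : ∀ k, 2 ≤ m k) {g : Gm m → ℂ} (hg : Integrable g (haar m))
    (i : ℕ) : Integrable (fun x => g x * conj (psi m i x)) (haar m) := by
  refine hg.mul_bdd (c := 1)
    (Complex.continuous_conj.measurable.comp (measurable_psi hm i)).aestronglyMeasurable ?_
  exact ae_of_all _ fun x => by simp [norm_psi hm]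

theorem integrable_psi (hm : ∀ k, 2 ≤ m k) (i : ℕ) : Integrable (psi m i) (haar m) :=
  Integrable.of_bound (measurable_psi hm i).aestronglyMeasurable 1
    (ae_of_all _ fun x => (norm_psi hm i x).le)

theorem partialSum_eq_integral (hm : ∀ k, 2 ≤ m k) {g : Gm m → ℂ} (hg : Integrable g (haar m))
    (k : ℕ) (x : Gm m) : partialSum m g k x = ∫ t, g t * kernel m k x t ∂haar m := by
  simp only [partialSum, kernel, fourierCoeff, Finset.mul_sum]
  rw [integral_finsetSum]
  · refine Finset.sum_congr rfl fun i _ => ?_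
    rw [← integral_mul_const]
    congr 1
    ext t
    ring
  · intro i _
    have := (integrable_mul_conj_psi hm hg i).mul_const (psi m i x)
    refine this.congr (ae_of_all _ fun t => ?_)
    simp only; ring

/-- Since `D_{M_n}` is `M_n` times the indicator of an interval of measure `1 / M_n`, the operator
`S_{M_n}` is the conditional expectation on `F_n`. -/
theorem partialSum_M_eq_setIntegral (hm : ∀ k, 2 ≤ m k) {g : Gm m → ℂ}
    (hg : Integrable g (haar m)) (n : ℕ) (x : Gm m) :
    partialSum m g (M m n) x = M m n * ∫ t in interval m n x, g t ∂haar m := by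
  rw [partialSum_eq_integral hm hg, ← integral_indicator (measurableSet_interval m n x),
    ← integral_const_mul]
  congr 1
  ext t
  by_cases h : t ∈ interval m n x
  · rw [Set.indicator_of_mem h, kernel_M_eq hm (mem_interval_comm.1 h), mul_comm]
  · rw [Set.indicator_of_notMem h, kernel_M_eq_zero hm (fun h' => h (mem_interval_comm.1 h'))]
    simp

theorem partialSum_M_of_stronglyMeasurable (hm : ∀ k, 2 ≤ m k) {g : Gm m → ℂ}
    (hg : Integrable g (haar m)) {n : ℕ} (hgn : StronglyMeasurable[filtration m n] g) (x : Gm m) :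
    partialSum m g (M m n) x = g x := by
  rw [partialSum_M_eq_setIntegral hm hg,
    setIntegral_congr_fun (g := fun _ => g x) (measurableSet_interval m n x)
      fun t ht => eq_of_stronglyMeasurable_filtration hgn ht]
  have h : (M m n : ℂ) ≠ 0 := Nat.cast_ne_zero.2 (M_pos n).ne'
  rw [setIntegral_const, Measure.real, haar_interval]
  simp [h]

theorem partialSum_M_martingale (hm : ∀ k, 2 ≤ m k) {f : ℕ → Gm m → ℂ}
    (hf : Martingale f (filtration m) (haar m)) (k n : ℕ) (x : Gm m) :
    partialSum m (f k) (M m n) x = f (min k n) x := by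
  rcases le_total k n with h | h
  · rw [min_eq_left h, partialSum_M_of_stronglyMeasurable hm (hf.integrable k)
      ((hf.1 k).mono ((filtration m).mono h))]
  · rw [min_eq_right h, ← partialSum_M_of_stronglyMeasurable hm (hf.integrable n) (hf.1 n),
      partialSum_M_eq_setIntegral hm (hf.integrable k),
      partialSum_M_eq_setIntegral hm (hf.integrable n),
      hf.setIntegral_eq h (measurableSet_filtration_interval n x)]

theorem fourierCoeff_psi_self (hm : ∀ k, 2 ≤ m k) (i : ℕ) : fourierCoeff m (psi m i) i = 1 := by
  have : ∀ x, psi m i x * conj (psi m i x) = 1 := fun x => by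
    rw [Complex.mul_conj, Complex.normSq_eq_norm_sq, norm_psi hm]; simp
  simp [fourierCoeff, this]

theorem fourierCoeff_sum {ι : Type*} (hm : ∀ k, 2 ≤ m k) (s : Finset ι) {g : ι → Gm m → ℂ}
    (hg : ∀ a ∈ s, Integrable (g a) (haar m)) (i : ℕ) :
    fourierCoeff m (fun x => ∑ a ∈ s, g a x) i = ∑ a ∈ s, fourierCoeff m (g a) i := by
  simp only [fourierCoeff, Finset.sum_mul]
  exact integral_finsetSum _ fun a ha => integrable_mul_conj_psi hm (hg a ha) i

/-- Orthogonality follows from reproduction: `ψ_i` equals its own partial sum of order `M_n`, and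
taking the `i`-th coefficient gives `∑ |c_l|² = 1`. As `c_i = 1` already, all other coefficients
vanish. -/
theorem fourierCoeff_psi (hm : ∀ k, 2 ≤ m k) (i j : ℕ) :
    fourierCoeff m (psi m i) j = if i = j then 1 else 0 := by
  split_ifs with h
  · rw [h, fourierCoeff_psi_self hm]
  obtain ⟨n, hn⟩ := exists_lt_M hm (max i j)
  have hi : i < M m n := (le_max_left _ _).trans_lt hn
  have hj : j < M m n := (le_max_right _ _).trans_lt hn
  set c := fourierCoeff m (psi m i) with hc
  have h1 : psi m i = fun x => ∑ l ∈ Finset.range (M m n), c l * psi m l x := by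
    ext x
    exact (partialSum_M_of_stronglyMeasurable hm (integrable_psi hm i)
      (stronglyMeasurable_filtration_psi hi) x).symm
  have h2 : ∑ l ∈ Finset.range (M m n), ‖c l‖ ^ 2 = 1 := by
    have h3 := fourierCoeff_psi_self hm i
    nth_rw 1 [h1] at h3
    rw [fourierCoeff_sum hm _ fun l _ => (integrable_psi hm l).const_mul _] at h3
    have h4 : ∀ l ∈ Finset.range (M m n),
        fourierCoeff m (fun x => c l * psi m l x) i = ((‖c l‖ ^ 2 : ℝ) : ℂ) := fun l _ => by
      rw [fourierCoeff_const_mul, ← conj_fourierCoeff_psi, ← hc, Complex.mul_conj,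
        Complex.normSq_eq_norm_sq]
    rw [Finset.sum_congr rfl h4] at h3
    exact_mod_cast h3
  have h5 : ∑ l ∈ {i, j}, ‖c l‖ ^ 2 ≤ ∑ l ∈ Finset.range (M m n), ‖c l‖ ^ 2 := by
    refine Finset.sum_le_sum_of_subset_of_nonneg ?_ fun _ _ _ => by positivity
    intro l hl
    simp only [Finset.mem_insert, Finset.mem_singleton] at hl
    rcases hl with rfl | rfl <;> simpa
  rw [h2, Finset.sum_pair h, hc, fourierCoeff_psi_self hm, ← hc] at h5
  have h6 : ‖c j‖ ^ 2 ≤ 0 := by simpa using h5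
  simpa using le_antisymm h6 (by positivity)

theorem fourierCoeff_partialSum (hm : ∀ k, 2 ≤ m k) (g : Gm m → ℂ) (k i : ℕ) :
    fourierCoeff m (partialSum m g k) i = if i < k then fourierCoeff m g i else 0 := by
  have : partialSum m g k =
      fun x => ∑ l ∈ Finset.range k, fourierCoeff m g l * psi m l x := rfl
  rw [this, fourierCoeff_sum hm _ fun l _ => (integrable_psi hm l).const_mul _]
  simp [fourierCoeff_const_mul, fourierCoeff_psi hm]

theorem fourierCoeff_eq_zero (hm : ∀ k, 2 ≤ m k) {g : Gm m → ℂ}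
    (hg : Integrable g (haar m)) {n : ℕ} (hgn : StronglyMeasurable[filtration m n] g) {i : ℕ}
    (hi : M m n ≤ i) : fourierCoeff m g i = 0 := by
  have : partialSum m g (M m n) = g :=
    funext (partialSum_M_of_stronglyMeasurable hm hg hgn)
  rw [← this, fourierCoeff_partialSum hm, if_neg hi.not_gt]

theorem fourierCoeff_martingale (hm : ∀ k, 2 ≤ m k) {f : ℕ → Gm m → ℂ}
    (hf : Martingale f (filtration m) (haar m)) {k n i : ℕ} (hi : i < M m n) (hk : n ≤ k) :
    fourierCoeff m (f k) i = fourierCoeff m (f n) i := by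
  have : partialSum m (f k) (M m n) = f n := by
    ext x; rw [partialSum_M_martingale hm hf, min_eq_right hk]
  rw [← this, fourierCoeff_partialSum hm, if_pos hi]

theorem martCoeff_eq (hm : ∀ k, 2 ≤ m k) {f : ℕ → Gm m → ℂ}
    (hf : Martingale f (filtration m) (haar m)) {n i : ℕ} (hi : i < M m n) :
    martCoeff m f i = fourierCoeff m (f n) i := by
  refine Tendsto.limUnder_eq (tendsto_const_nhds.congr' ?_)
  filter_upwards [eventually_ge_atTop n] with k hk
  rw [fourierCoeff_martingale hm hf hi hk]

theorem martPartialSum_eq (hm : ∀ k, 2 ≤ m k) {f : ℕ → Gm m → ℂ}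
    (hf : Martingale f (filtration m) (haar m)) {n k : ℕ} (hk : k ≤ M m n) (x : Gm m) :
    martPartialSum m f k x = partialSum m (f n) k x :=
  Finset.sum_congr rfl fun i hi => by
    rw [martCoeff_eq hm hf ((Finset.mem_range.1 hi).trans_le hk)]

/-- For `M_n ≤ k ≤ M_{n+1}`, `S_k f - f_n` is the partial sum of the martingale difference. -/
theorem martPartialSum_sub_eq (hm : ∀ k, 2 ≤ m k) {f : ℕ → Gm m → ℂ}
    (hf : Martingale f (filtration m) (haar m)) {n k : ℕ} (hn : M m n ≤ k)
    (hk : k ≤ M m (n + 1)) (x : Gm m) :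
    martPartialSum m f k x - f n x = partialSum m (fun y => f (n + 1) y - f n y) k x := by
  -- The coefficients of `f_n` vanish from index `M_n` on, so extending the sum from `M_n` to `k`
  -- changes nothing.
  have h1 : partialSum m (f n) k x = f n x := by
    rw [← partialSum_M_of_stronglyMeasurable hm (hf.integrable n) (hf.1 n)]
    refine (Finset.sum_subset (Finset.range_mono hn) fun i _ hi => ?_).symm
    rw [fourierCoeff_eq_zero hm (hf.integrable n) (hf.1 n) (by simpa using hi), zero_mul]
  rw [martPartialSum_eq hm hf hk, ← h1]
  simp only [partialSum]
  rw [← Finset.sum_sub_distrib]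
  refine Finset.sum_congr rfl fun i _ => ?_
  rw [← sub_mul, fourierCoeff, fourierCoeff, fourierCoeff, ← integral_sub
    (integrable_mul_conj_psi hm (hf.integrable _) i) (integrable_mul_conj_psi hm (hf.integrable _) i)]
  simp only [sub_mul]

end Fourier

/-! ### Geometric series in the generalized powers -/

section Series

variable {m : ℕ → ℕ}

theorem M_mul_two_pow_le (hm : ∀ k, 2 ≤ m k) (n j : ℕ) : M m n * 2 ^ j ≤ M m (n + j) := by
  induction j with
  | zero => simp
  | succ j ih =>
    rw [pow_succ, ← mul_assoc, ← add_assoc, M_succ]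
    exact Nat.mul_le_mul ih (hm _)

theorem tsum_two_rpow_lt_top {p : ℝ} (hp1 : p < 1) : ∑' j : ℕ, ((2 : ℝ≥0∞) ^ (p - 1)) ^ j < ∞ := by
  rw [ENNReal.tsum_geometric, ENNReal.inv_lt_top, tsub_pos_iff_lt]
  exact ENNReal.rpow_lt_one_of_one_lt_of_neg ENNReal.one_lt_two (by linarith)

variable [∀ k, NeZero (m k)]

theorem natCast_M_ne_zero (n : ℕ) : (M m n : ℝ≥0∞) ≠ 0 := Nat.cast_ne_zero.2 (M_pos n).ne'

/-- The terms are `M_{n+j}^{p-1}` with a negative exponent, and `M_{n+j} ≥ 2^j M_n`. -/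
theorem tsum_M_rpow_mul_inv_le (hm : ∀ k, 2 ≤ m k) {p : ℝ} (hp1 : p < 1) (n : ℕ) :
    ∑' j, (M m (n + j) : ℝ≥0∞) ^ p * (M m (n + j) : ℝ≥0∞)⁻¹ ≤
      (M m n : ℝ≥0∞) ^ (p - 1) * ∑' j : ℕ, ((2 : ℝ≥0∞) ^ (p - 1)) ^ j := by
  rw [← ENNReal.tsum_mul_left]
  refine ENNReal.tsum_le_tsum fun j => ?_
  have h1 : (M m (n + j) : ℝ≥0∞) ^ p * (M m (n + j) : ℝ≥0∞)⁻¹ = (M m (n + j) : ℝ≥0∞) ^ (p - 1) := by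
    rw [← ENNReal.rpow_neg_one, ← ENNReal.rpow_add _ _ (natCast_M_ne_zero _) (by simp)]
    ring_nf
  have h2 : ((2 : ℝ≥0∞) ^ (p - 1)) ^ j = ((2 : ℝ≥0∞) ^ j) ^ (p - 1) := by
    rw [← ENNReal.rpow_natCast, ← ENNReal.rpow_natCast, ← ENNReal.rpow_mul, ← ENNReal.rpow_mul,
      mul_comm]
  rw [h1, h2, ← ENNReal.mul_rpow_of_ne_top (by simp) (by simp)]
  rw [← neg_sub, ENNReal.rpow_neg, ENNReal.rpow_neg, ENNReal.inv_le_inv]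
  refine ENNReal.rpow_le_rpow ?_ (by linarith)
  exact_mod_cast M_mul_two_pow_le hm n j

end Series

/-! ### Weak and strong quasi-norms -/

section Norms

variable {m : ℕ → ℕ}

theorem hpNorm_rpow {p : ℝ} (hp : 0 < p) (f : ℕ → Gm m → ℂ) :
    hpNorm m p f ^ p = ∫⁻ x, maximalFunction f x ^ p ∂haar m := by
  rw [hpNorm, one_div, ENNReal.rpow_inv_rpow hp.ne']

theorem weakLpNorm_le {p : ℝ} (hp : 0 < p) {g : Gm m → ℂ} (hg : Measurable g) :
    weakLpNorm m p g ≤ (∫⁻ x, ‖g x‖ₑ ^ p ∂haar m) ^ (1 / p) := by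
  refine iSup₂_le fun t _ => ?_
  have h1 : ((t : ℝ≥0∞) * haar m {x | (t : ℝ≥0∞) < ‖g x‖ₑ} ^ (1 / p)) =
      ((t : ℝ≥0∞) ^ p * haar m {x | (t : ℝ≥0∞) < ‖g x‖ₑ}) ^ (1 / p) := by
    rw [ENNReal.mul_rpow_of_nonneg _ _ (by positivity), one_div, ENNReal.rpow_rpow_inv hp.ne']
  rw [h1]
  gcongr
  refine le_trans ?_ (mul_meas_ge_le_lintegral₀ (hg.enorm.pow_const p).aemeasurable
    ((t : ℝ≥0∞) ^ p))
  gcongr with x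
  intro hx
  exact ENNReal.rpow_le_rpow hx.le hp.le

/-- A value taken at one point is taken on a set of measure `1 / M_n`, which bounds `sup h^p` by
`M_n ∫ h^p`. Integrating `h = h^p * h^{1-p}` with this bound on the second factor gives the claim.
-/
theorem lintegral_rpow_interval_invariant_le [∀ k, NeZero (m k)] {p : ℝ} (hp0 : 0 < p)
    (hp1 : p ≤ 1) {n : ℕ} {h : Gm m → ℝ≥0∞} (hmeas : Measurable h)
    (hh : ∀ x y, y ∈ interval m n x → h y = h x) :
    (∫⁻ x, h x ∂haar m) ^ p ≤ (M m n : ℝ≥0∞) ^ (1 - p) * ∫⁻ x, h x ^ p ∂haar m := by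
  set A := ∫⁻ x, h x ^ p ∂haar m with hA
  have h1 : ∀ x, h x ^ p ≤ M m n * A := fun x => by
    have : h x ^ p * (M m n : ℝ≥0∞)⁻¹ ≤ A := by
      rw [← haar_interval n x, ← setLIntegral_const]
      refine le_trans (le_of_eq ?_) (setLIntegral_le_lintegral (interval m n x) _)
      exact setLIntegral_congr_fun (measurableSet_interval m n x) fun y hy => by
        rw [hh x y hy]
    rw [← div_eq_mul_inv, ENNReal.div_le_iff (natCast_M_ne_zero n) (by simp)] at this
    rwa [mul_comm]
  have h2 : ∀ x, h x ≤ h x ^ p * (M m n * A) ^ ((1 - p) / p) := fun x => by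
    calc h x = h x ^ (p + (1 - p)) := by simp
      _ = h x ^ p * (h x ^ p) ^ ((1 - p) / p) := by
        rw [ENNReal.rpow_add_of_nonneg _ _ hp0.le (by linarith), ← ENNReal.rpow_mul,
          mul_div_cancel₀ _ hp0.ne']
      _ ≤ _ := by
        gcongr
        exact h1 x
  calc (∫⁻ x, h x ∂haar m) ^ p ≤ (A * (M m n * A) ^ ((1 - p) / p)) ^ p := by
        refine ENNReal.rpow_le_rpow ((lintegral_mono h2).trans (le_of_eq ?_)) hp0.le
        rw [lintegral_mul_const _ (hmeas.pow_const p)]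
    _ = (M m n : ℝ≥0∞) ^ (1 - p) * A := by
        rw [ENNReal.mul_rpow_of_nonneg _ _ hp0.le, ← ENNReal.rpow_mul, div_mul_cancel₀ _ hp0.ne',
          ENNReal.mul_rpow_of_nonneg _ _ (by linarith), mul_left_comm,
          ← ENNReal.rpow_add_of_nonneg _ _ hp0.le (by linarith)]
        simp

end Norms

/-! ### `L_p` bounds for the partial sum operators -/

section PartialSums

variable {m : ℕ → ℕ} [∀ k, NeZero (m k)]

theorem measurable_kernel (hm : ∀ k, 2 ≤ m k) (k : ℕ) :
    Measurable fun z : Gm m × Gm m => kernel m k z.1 z.2 := by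
  unfold kernel
  refine Finset.measurable_fun_sum _ fun i _ => ?_
  exact ((measurable_psi hm i).comp measurable_fst).mul
    (Complex.continuous_conj.measurable.comp ((measurable_psi hm i).comp measurable_snd))

theorem measurable_martPartialSum (hm : ∀ k, 2 ≤ m k) (f : ℕ → Gm m → ℂ) (k : ℕ) :
    Measurable (martPartialSum m f k) :=
  Finset.measurable_fun_sum _ fun i _ => (measurable_psi hm i).const_mul _

theorem lintegral_tsum_indicator_interval (c : ℕ → ℝ≥0∞) (t : Gm m) (u : ℕ → ℕ) :
    ∫⁻ x, ∑' s, (interval m (u s) t).indicator (fun _ => c s) x ∂haar m =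
      ∑' s, c s * (M m (u s) : ℝ≥0∞)⁻¹ := by
  rw [lintegral_tsum fun s =>
    (measurable_const.indicator (measurableSet_interval m (u s) t)).aemeasurable]
  congr 1
  ext s
  rw [lintegral_indicator_const (measurableSet_interval m _ t), haar_interval]

/-- Integrating the interval majorant gives `∑ M_{s+1}^p / M_s`; the bound `M_{s+1} ≤ b M_s` reduces
it to the convergent `∑ M_s^{p-1}`. -/
theorem lintegral_kernel_le (hm : ∀ k, 2 ≤ m k) {p : ℝ} (hp0 : 0 < p) (hp1 : p < 1) {b : ℕ}
    (hb : ∀ k, m k ≤ b) (k : ℕ) (t : Gm m) :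
    ∫⁻ x, ‖kernel m k x t‖ₑ ^ p ∂haar m ≤
      (b : ℝ≥0∞) ^ p * ∑' j : ℕ, ((2 : ℝ≥0∞) ^ (p - 1)) ^ j := by
  refine (lintegral_mono (enorm_kernel_rpow_le hm hp0 k · t)).trans ?_
  rw [lintegral_tsum_indicator_interval _ _ fun s => s]
  have h1 := tsum_M_rpow_mul_inv_le hm hp1 0
  rw [M_zero, Nat.cast_one, ENNReal.one_rpow, one_mul] at h1
  refine le_trans ?_ (mul_le_mul_right h1 _)
  rw [← ENNReal.tsum_mul_left]
  refine ENNReal.tsum_le_tsum fun s => ?_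
  rw [zero_add, ← mul_assoc, ← ENNReal.mul_rpow_of_nonneg _ _ hp0.le]
  gcongr
  rw [M_succ, mul_comm]
  exact_mod_cast Nat.mul_le_mul_right _ (hb s)

theorem kernel_congr_right {k n : ℕ} (hk : k ≤ M m n) (x : Gm m) {s t : Gm m}
    (h : t ∈ interval m n s) : kernel m k x t = kernel m k x s :=
  Finset.sum_congr rfl fun i hi => by
    rw [psi_congr ((Finset.mem_range.1 hi).trans_le hk) h]

/-- For `k ≤ M_n` the kernel is, like `g`, constant in `t` on intervals of order `n`, so the power
`p < 1` can be moved inside the integral at the cost of `M_n^{1-p}`. -/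
theorem enorm_partialSum_rpow_le (hm : ∀ k, 2 ≤ m k) {p : ℝ} (hp0 : 0 < p) (hp1 : p < 1)
    {g : Gm m → ℂ} (hg : Integrable g (haar m)) {n k : ℕ}
    (hgn : StronglyMeasurable[filtration m n] g) (hk : k ≤ M m n) (x : Gm m) :
    ‖partialSum m g k x‖ₑ ^ p ≤
      (M m n : ℝ≥0∞) ^ (1 - p) * ∫⁻ t, ‖g t‖ₑ ^ p * ‖kernel m k x t‖ₑ ^ p ∂haar m := by
  have hgm : Measurable g := (hgn.mono ((filtration m).le n)).measurable
  have hKx : Measurable fun t => kernel m k x t :=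
    Finset.measurable_fun_sum _ fun i _ =>
      (Complex.continuous_conj.measurable.comp (measurable_psi hm i)).const_mul _
  have h1 : ‖partialSum m g k x‖ₑ ≤ ∫⁻ t, ‖g t‖ₑ * ‖kernel m k x t‖ₑ ∂haar m := by
    rw [partialSum_eq_integral hm hg]
    refine (enorm_integral_le_lintegral_enorm _).trans_eq ?_
    simp only [enorm_mul]
  have h2 : ∀ s t, t ∈ interval m n s →
      ‖g t‖ₑ * ‖kernel m k x t‖ₑ = ‖g s‖ₑ * ‖kernel m k x s‖ₑ := fun s t hst => by
    rw [eq_of_stronglyMeasurable_filtration hgn hst, kernel_congr_right hk x hst]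
  have hmeas : Measurable fun t => ‖g t‖ₑ * ‖kernel m k x t‖ₑ := hgm.enorm.mul hKx.enorm
  have h3 := lintegral_rpow_interval_invariant_le hp0 hp1.le hmeas h2
  simp only [ENNReal.mul_rpow_of_nonneg _ _ hp0.le] at h3
  exact (ENNReal.rpow_le_rpow h1 hp0.le).trans h3

/-- On functions that are constant on the intervals of length `1 / M_n`, the partial sums `S_k`,
`k ≤ M_n`, have `L_p` norm of order `M_n ^ (1 / p - 1)`. -/
theorem lintegral_partialSum_le (hm : ∀ k, 2 ≤ m k) {p : ℝ} (hp0 : 0 < p) (hp1 : p < 1)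
    {g : Gm m → ℂ} (hg : Integrable g (haar m)) {n k : ℕ}
    (hgn : StronglyMeasurable[filtration m n] g) (hk : k ≤ M m n) {C : ℝ≥0∞}
    (hC : ∀ t, ∫⁻ x, ‖kernel m k x t‖ₑ ^ p ∂haar m ≤ C) :
    ∫⁻ x, ‖partialSum m g k x‖ₑ ^ p ∂haar m ≤
      C * (M m n : ℝ≥0∞) ^ (1 - p) * ∫⁻ x, ‖g x‖ₑ ^ p ∂haar m := by
  have hgm : Measurable g := (hgn.mono ((filtration m).le n)).measurable
  have hK := measurable_kernel hm k
  have hmeas : Measurable fun z : Gm m × Gm m => ‖g z.2‖ₑ ^ p * ‖kernel m k z.1 z.2‖ₑ ^ p :=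
    ((hgm.comp measurable_snd).enorm.pow_const p).mul (hK.enorm.pow_const p)
  have hM : (M m n : ℝ≥0∞) ^ (1 - p) ≠ ∞ :=
    ENNReal.rpow_ne_top_of_nonneg (by linarith) (ENNReal.natCast_ne_top _)
  have h1 : ∫⁻ t, ∫⁻ x, ‖g t‖ₑ ^ p * ‖kernel m k x t‖ₑ ^ p ∂haar m ∂haar m ≤
      (∫⁻ t, ‖g t‖ₑ ^ p ∂haar m) * C := by
    rw [← lintegral_mul_const _ (hgm.enorm.pow_const p)]
    refine lintegral_mono fun t => ?_
    have hKt : Measurable fun x => ‖kernel m k x t‖ₑ ^ p :=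
      (hK.comp measurable_prodMk_right).enorm.pow_const p
    rw [lintegral_const_mul _ hKt]
    exact mul_le_mul_right (hC t) _
  refine (lintegral_mono (enorm_partialSum_rpow_le hm hp0 hp1 hg hgn hk)).trans ?_
  rw [lintegral_const_mul' _ _ hM, lintegral_lintegral_swap hmeas.aemeasurable]
  refine (mul_le_mul_right h1 _).trans_eq ?_
  ring

end PartialSums

/-! ### Almost everywhere limits and the error estimate for (a) -/

section Limit

variable {m : ℕ → ℕ}

theorem measurable_martingale {f : ℕ → Gm m → ℂ} (hf : Martingale f (filtration m) (haar m))
    (n : ℕ) : Measurable (f n) :=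
  ((hf.1 n).mono ((filtration m).le n)).measurable

theorem enorm_sub_le_maximalFunction (f : ℕ → Gm m → ℂ) {n k : ℕ} (h : n ≤ k) (x : Gm m) :
    ‖f k x - f n x‖ₑ ≤ maximalFunction (fun k x => f k x - f (min k n) x) x := by
  refine le_trans (le_of_eq ?_) (le_iSup (fun k => ‖f k x - f (min k n) x‖ₑ) k)
  rw [min_eq_right h]

theorem measurable_maximalFunction {f : ℕ → Gm m → ℂ} (hf : ∀ n, Measurable (f n)) :
    Measurable (maximalFunction f) :=
  Measurable.iSup fun n => (hf n).enorm

variable [∀ k, NeZero (m k)]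

theorem modulus_eq (hm : ∀ k, 2 ≤ m k) (p : ℝ) {f : ℕ → Gm m → ℂ}
    (hf : Martingale f (filtration m) (haar m)) (n : ℕ) :
    modulus m p f n = hpNorm m p fun k x => f k x - f (min k n) x := by
  simp only [modulus, partialSum_M_martingale hm hf]

/-- A martingale whose moduli of continuity tend to zero converges almost everywhere. -/
theorem ae_exists_tendsto (hm : ∀ k, 2 ≤ m k) {p : ℝ} (hp0 : 0 < p) {f : ℕ → Gm m → ℂ}
    (hf : Martingale f (filtration m) (haar m))
    (hmod : Tendsto (modulus m p f) atTop (𝓝 0)) :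
    ∀ᵐ x ∂haar m, ∃ l, Tendsto (fun n => f n x) atTop (𝓝 l) := by
  set W : ℕ → Gm m → ℝ≥0∞ := fun n => maximalFunction fun k x => f k x - f (min k n) x
  have hW : ∀ n, Measurable (W n) := fun n => measurable_maximalFunction fun k =>
    (measurable_martingale hf k).sub (measurable_martingale hf _)
  have h1 : Tendsto (fun n => ∫⁻ x, W n x ^ p ∂haar m) atTop (𝓝 0) := by
    have h2 : ∀ n, ∫⁻ x, W n x ^ p ∂haar m = modulus m p f n ^ p := fun n => by
      rw [modulus_eq hm p hf, hpNorm_rpow hp0]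
    simp only [h2]
    simpa [ENNReal.zero_rpow_of_pos hp0] using hmod.ennrpow_const p
  -- By Fatou the oscillation `W n x` after time `n` is arbitrarily small for suitable `n`, at
  -- almost every `x`; this is the Cauchy property.
  have h3 : ∫⁻ x, liminf (fun n => W n x ^ p) atTop ∂haar m = 0 := by
    refine le_antisymm ?_ zero_le
    rw [← h1.liminf_eq]
    exact lintegral_liminf_le fun n => (hW n).pow_const p
  rw [lintegral_eq_zero_iff (.liminf fun n => (hW n).pow_const p)] at h3
  filter_upwards [h3] with x hx
  refine cauchySeq_tendsto_of_complete (EMetric.cauchySeq_iff'.2 fun ε hε => ?_)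
  have h4 : liminf (fun n => W n x ^ p) atTop < ε ^ p := by
    rw [hx]; exact ENNReal.rpow_pos_of_nonneg hε hp0.le
  obtain ⟨n, hn⟩ := (frequently_lt_of_liminf_lt (by isBoundedDefault) h4).exists
  refine ⟨n, fun k hk => ?_⟩
  rw [edist_eq_enorm_sub]
  exact (enorm_sub_le_maximalFunction f hk x).trans_lt ((ENNReal.rpow_lt_rpow_iff hp0).1 hn)

theorem exists_isLimitFunction (hm : ∀ k, 2 ≤ m k) {p : ℝ} (hp0 : 0 < p) {f : ℕ → Gm m → ℂ}
    (hf : MemHp m p f) (hmod : Tendsto (modulus m p f) atTop (𝓝 0)) :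
    ∃ F, MemWeakLp m p F ∧ IsLimitFunction m f F := by
  obtain ⟨F, hF, hlim⟩ := measurable_limit_of_tendsto_metrizable_ae
    (fun n => (measurable_martingale hf.1 n).aemeasurable) (ae_exists_tendsto hm hp0 hf.1 hmod)
  refine ⟨F, ⟨hF, ?_⟩, hlim⟩
  refine (weakLpNorm_le hp0 hF).trans_lt (lt_of_le_of_lt ?_ hf.2)
  rw [hpNorm]
  gcongr ?_ ^ _
  refine lintegral_mono_ae ?_
  filter_upwards [hlim] with x hx
  gcongr
  exact le_of_tendsto hx.enorm (Eventually.of_forall fun n => le_iSup (fun n => ‖f n x‖ₑ) n)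

theorem lintegral_sub_limit_le (hm : ∀ k, 2 ≤ m k) {p : ℝ} (hp0 : 0 < p) {f : ℕ → Gm m → ℂ}
    (hf : Martingale f (filtration m) (haar m)) {F : Gm m → ℂ} (hF : IsLimitFunction m f F)
    (n : ℕ) : ∫⁻ x, ‖f n x - F x‖ₑ ^ p ∂haar m ≤ modulus m p f n ^ p := by
  rw [modulus_eq hm p hf, hpNorm_rpow hp0]
  refine lintegral_mono_ae ?_
  filter_upwards [hF] with x hx
  gcongr
  rw [← enorm_neg, neg_sub]
  refine le_of_tendsto (hx.sub_const (f n x)).enorm ?_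
  filter_upwards [eventually_ge_atTop n] with k hk
  exact enorm_sub_le_maximalFunction f hk x

theorem lintegral_diff_le (hm : ∀ k, 2 ≤ m k) {p : ℝ} (hp0 : 0 < p) {f : ℕ → Gm m → ℂ}
    (hf : Martingale f (filtration m) (haar m)) (n : ℕ) :
    ∫⁻ x, ‖f (n + 1) x - f n x‖ₑ ^ p ∂haar m ≤ modulus m p f n ^ p := by
  rw [modulus_eq hm p hf, hpNorm_rpow hp0]
  refine lintegral_mono fun x => ?_
  gcongr
  exact enorm_sub_le_maximalFunction f n.le_succ x

theorem exists_M_le_lt (hm : ∀ k, 2 ≤ m k) {N k : ℕ} (hk : M m N ≤ k) :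
    ∃ n, N ≤ n ∧ M m n ≤ k ∧ k < M m (n + 1) := by
  classical
  have h := exists_lt_M hm k
  have h1 : N < Nat.find h := (M_mono.reflect_lt (hk.trans_lt (Nat.find_spec h)))
  refine ⟨Nat.find h - 1, by omega, not_lt.1 (Nat.find_min h (by omega)), ?_⟩
  rw [Nat.sub_add_cancel (by omega)]
  exact Nat.find_spec h

theorem weakLpNorm_martPartialSum_sub_le (hm : ∀ k, 2 ≤ m k) {p : ℝ} (hp0 : 0 < p) (hp1 : p < 1)
    {b : ℕ} (hb : ∀ k, m k ≤ b) {f : ℕ → Gm m → ℂ} (hf : Martingale f (filtration m) (haar m))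
    {F : Gm m → ℂ} (hFm : Measurable F) (hF : IsLimitFunction m f F) {n k : ℕ} (hn : M m n ≤ k)
    (hk : k ≤ M m (n + 1)) :
    weakLpNorm m p (fun x => martPartialSum m f k x - F x) ≤
      (((b : ℝ≥0∞) ^ p * ∑' j : ℕ, ((2 : ℝ≥0∞) ^ (p - 1)) ^ j) * (b : ℝ≥0∞) ^ (1 - p) + 1) ^
        (1 / p) * (modulus m p f n * (M m n : ℝ≥0∞) ^ (1 / p - 1)) := by
  set C := (b : ℝ≥0∞) ^ p * ∑' j : ℕ, ((2 : ℝ≥0∞) ^ (p - 1)) ^ j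
  refine (weakLpNorm_le hp0 ((measurable_martPartialSum hm f k).sub hFm)).trans ?_
  have h1 : ∫⁻ x, ‖martPartialSum m f k x - f n x‖ₑ ^ p ∂haar m ≤
      C * (M m (n + 1) : ℝ≥0∞) ^ (1 - p) * modulus m p f n ^ p := by
    simp only [martPartialSum_sub_eq hm hf hn hk]
    refine (lintegral_partialSum_le hm hp0 hp1
      ((hf.integrable (n + 1)).sub (hf.integrable n))
      ((hf.1 (n + 1)).sub ((hf.1 n).mono ((filtration m).mono n.le_succ))) hk
      (lintegral_kernel_le hm hp0 hp1 hb k)).trans ?_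
    gcongr
    exact lintegral_diff_le hm hp0 hf n
  have h2 : (M m (n + 1) : ℝ≥0∞) ^ (1 - p) ≤
      (b : ℝ≥0∞) ^ (1 - p) * (M m n : ℝ≥0∞) ^ (1 - p) := by
    rw [← ENNReal.mul_rpow_of_nonneg _ _ (by linarith)]
    gcongr
    rw [M_succ, mul_comm]
    exact_mod_cast Nat.mul_le_mul_right _ (hb n)
  -- The error of `f_n` against `F` carries no factor `M_n^{1-p}`; inserting it is harmless and
  -- accounts for the `+ 1` in the constant.
  have h3 : (1 : ℝ≥0∞) ≤ (M m n : ℝ≥0∞) ^ (1 - p) :=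
    ENNReal.one_le_rpow (by exact_mod_cast M_pos (m := m) n) (by linarith)
  have h4 : ∫⁻ x, ‖martPartialSum m f k x - F x‖ₑ ^ p ∂haar m ≤
      (C * (b : ℝ≥0∞) ^ (1 - p) + 1) * (modulus m p f n * (M m n : ℝ≥0∞) ^ (1 / p - 1)) ^ p := by
    calc ∫⁻ x, ‖martPartialSum m f k x - F x‖ₑ ^ p ∂haar m
        ≤ ∫⁻ x, (‖martPartialSum m f k x - f n x‖ₑ ^ p + ‖f n x - F x‖ₑ ^ p) ∂haar m := by
          refine lintegral_mono fun x => ?_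
          refine le_trans ?_ (ENNReal.rpow_add_le_add_rpow _ _ hp0.le hp1.le)
          gcongr
          rw [← sub_add_sub_cancel _ (f n x)]
          exact enorm_add_le _ _
      _ ≤ C * (M m (n + 1) : ℝ≥0∞) ^ (1 - p) * modulus m p f n ^ p + modulus m p f n ^ p := by
          have hmeas : Measurable fun x => ‖martPartialSum m f k x - f n x‖ₑ ^ p :=
            ((measurable_martPartialSum hm f k).sub (measurable_martingale hf n)).enorm.pow_const p
          rw [lintegral_add_left hmeas]
          exact add_le_add h1 (lintegral_sub_limit_le hm hp0 hf hF n)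
      _ ≤ C * ((b : ℝ≥0∞) ^ (1 - p) * (M m n : ℝ≥0∞) ^ (1 - p)) * modulus m p f n ^ p +
            (M m n : ℝ≥0∞) ^ (1 - p) * modulus m p f n ^ p := by
          gcongr
          exact le_mul_of_one_le_left zero_le h3
      _ = _ := by
          rw [ENNReal.mul_rpow_of_nonneg _ _ hp0.le, ← ENNReal.rpow_mul,
            show (1 / p - 1) * p = 1 - p by field_simp]
          ring
  refine (ENNReal.rpow_le_rpow h4 (by positivity)).trans (le_of_eq ?_)
  rw [ENNReal.mul_rpow_of_nonneg _ _ (by positivity), one_div, ENNReal.rpow_rpow_inv hp0.ne']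

end Limit

/-- The martingale difference `r_j D_{M_j} = ∑_{M_j ≤ i < 2 M_j} ψ_i`. -/
noncomputable def dirichletBlock (m : ℕ → ℕ) (j : ℕ) (x : Gm m) : ℂ :=
  ∑ i ∈ Finset.range (M m j), psi m (M m j + i) x

/-- The martingale `(∑_{j<n} r_j D_{M_j})_n`. -/
noncomputable def lacunaryMartingale (m : ℕ → ℕ) (n : ℕ) (x : Gm m) : ℂ :=
  ∑ j ∈ Finset.range n, dirichletBlock m j x

/-! ### The counterexample for (b) -/

section Lacunary

variable {m : ℕ → ℕ}

theorem psi_zero_right (i : ℕ) : psi m i 0 = 1 := by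
  have : ∀ k, rademacher m k 0 = 1 := fun k => by simp [rademacher]
  simp [psi, this]

theorem rpow_enorm_sum_le {ι : Type*} {p : ℝ} (hp0 : 0 < p) (hp1 : p ≤ 1) (s : Finset ι)
    (g : ι → ℂ) : ‖∑ i ∈ s, g i‖ₑ ^ p ≤ ∑ i ∈ s, ‖g i‖ₑ ^ p := by
  classical
  induction s using Finset.induction_on with
  | empty => simp [hp0]
  | insert a s ha ih =>
    rw [Finset.sum_insert ha, Finset.sum_insert ha]
    refine (ENNReal.rpow_le_rpow (enorm_add_le _ _) hp0.le).trans ?_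
    refine (ENNReal.rpow_add_le_add_rpow _ _ hp0.le hp1).trans ?_
    gcongr

theorem tendsto_M_rpow (hm : ∀ k, 2 ≤ m k) {a : ℝ} (ha : a < 0) :
    Tendsto (fun n => (M m n : ℝ≥0∞) ^ a) atTop (𝓝 0) := by
  have h1 : Tendsto (M m) atTop atTop :=
    tendsto_atTop_mono (fun n => Nat.lt_two_pow_self.le.trans (two_pow_le_M hm n)) tendsto_id
  have h2 : Tendsto (fun n => (M m n : ℝ≥0∞)) atTop (𝓝 ∞) :=
    ENNReal.tendsto_nat_nhds_top.comp h1
  simpa [ENNReal.top_rpow_of_neg ha] using h2.ennrpow_const a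

variable [∀ k, NeZero (m k)]

theorem dirichletBlock_eq (hm : ∀ k, 2 ≤ m k) (j : ℕ) (x : Gm m) :
    dirichletBlock m j x = rademacher m j x * kernel m (M m j) x 0 := by
  rw [dirichletBlock, kernel, Finset.mul_sum]
  refine Finset.sum_congr rfl fun i hi => ?_
  obtain ⟨N, hN⟩ := exists_lt_M hm (1 * M m j + i)
  have h := psi_mul_add (Finset.mem_range.1 hi) hN x
  rw [psi_mul_M (Nat.lt_of_succ_le (hm j)), pow_one, one_mul] at h
  rw [h, psi_zero_right, map_one, mul_one]

theorem enorm_dirichletBlock_rpow_le (hm : ∀ k, 2 ≤ m k) {p : ℝ} (hp0 : 0 < p) (j : ℕ)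
    (x : Gm m) : ‖dirichletBlock m j x‖ₑ ^ p ≤
      (interval m j 0).indicator (fun _ => (M m j : ℝ≥0∞) ^ p) x := by
  rw [dirichletBlock_eq hm]
  by_cases h : x ∈ interval m j 0
  · rw [Set.indicator_of_mem h, kernel_M_eq hm h, enorm_mul, ← ofReal_norm, norm_rademacher,
      ← ofReal_norm, Complex.norm_natCast]
    simp
  · simp [kernel_M_eq_zero hm h, hp0]

theorem integrable_dirichletBlock (hm : ∀ k, 2 ≤ m k) (j : ℕ) :
    Integrable (dirichletBlock m j) (haar m) :=
  integrable_finsetSum _ fun _ _ => integrable_psi hm _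

theorem dirichletBlock_congr (hm : ∀ k, 2 ≤ m k) {j n : ℕ} (hj : j < n) {x y : Gm m}
    (h : y ∈ interval m n x) : dirichletBlock m j y = dirichletBlock m j x := by
  refine Finset.sum_congr rfl fun i hi => psi_congr ?_ h
  have h1 := two_mul_M_le hm j
  have h2 := M_mono (m := m) (Nat.succ_le_of_lt hj)
  have h3 := Finset.mem_range.1 hi
  rw [Nat.succ_eq_add_one] at h2
  omega

/-- The conjugate of this integral is the `l`-th coefficient of the indicator of `s`, an
`F_n`-measurable function. -/
theorem setIntegral_psi_eq_zero (hm : ∀ k, 2 ≤ m k) {n l : ℕ} (hl : M m n ≤ l) {s : Set (Gm m)}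
    (hs : MeasurableSet[filtration m n] s) : ∫ x in s, psi m l x ∂haar m = 0 := by
  have hs' : MeasurableSet s := (filtration m).le n s hs
  have h1 : fourierCoeff m (s.indicator fun _ => 1) l = 0 :=
    fourierCoeff_eq_zero hm ((integrable_const 1).indicator hs')
      (stronglyMeasurable_const.indicator hs) hl
  rw [← map_eq_zero (starRingEnd ℂ), ← integral_conj, ← integral_indicator hs', ← h1,
    fourierCoeff]
  congr 1
  ext x
  by_cases h : x ∈ s <;> simp [h]

theorem martingale_lacunaryMartingale (hm : ∀ k, 2 ≤ m k) :
    Martingale (lacunaryMartingale m) (filtration m) (haar m) := by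
  have hint : ∀ n, Integrable (lacunaryMartingale m n) (haar m) := fun n =>
    integrable_finsetSum _ fun j _ => integrable_dirichletBlock hm j
  have hmeas : ∀ n, StronglyMeasurable[filtration m n] (lacunaryMartingale m n) := fun n =>
    stronglyMeasurable_filtration_of_forall fun x y h =>
      Finset.sum_congr rfl fun j hj => dirichletBlock_congr hm (Finset.mem_range.1 hj) h
  refine martingale_nat hmeas hint fun n => ?_
  refine ae_eq_condExp_of_forall_setIntegral_eq ((filtration m).le n) (hint _)
    (fun _ _ _ => (hint n).integrableOn) (fun s hs _ => ?_) (hmeas n).aestronglyMeasurable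
  have h1 : ∫ x in s, dirichletBlock m n x ∂haar m = 0 := by
    unfold dirichletBlock
    rw [integral_finsetSum _ fun i _ => (integrable_psi hm _).integrableOn]
    exact Finset.sum_eq_zero fun i _ => setIntegral_psi_eq_zero hm (Nat.le_add_right _ _) hs
  have h2 : lacunaryMartingale m (n + 1) =
      fun x => lacunaryMartingale m n x + dirichletBlock m n x :=
    funext fun x => Finset.sum_range_succ _ _
  rw [h2, integral_add (hint n).integrableOn (integrable_dirichletBlock hm n).integrableOn, h1,
    add_zero]

/-- Blocks `j < n` are `F_n`-measurable and have no coefficient at `M_n`; in block `n` this is the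
frequency of the term `i = 0`. -/
theorem martCoeff_lacunaryMartingale (hm : ∀ k, 2 ≤ m k) (n : ℕ) :
    martCoeff m (lacunaryMartingale m) (M m n) = 1 := by
  have h0 : M m n < M m (n + 1) := by
    have := two_mul_M_le hm n
    have := M_pos (m := m) n
    omega
  rw [martCoeff_eq hm (martingale_lacunaryMartingale hm) h0]
  unfold lacunaryMartingale
  rw [fourierCoeff_sum hm _ fun j _ => integrable_dirichletBlock hm j, Finset.sum_range_succ,
    Finset.sum_eq_zero, zero_add]
  · unfold dirichletBlock
    rw [fourierCoeff_sum hm _ fun i _ => integrable_psi hm _]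
    simp [fourierCoeff_psi hm, (M_pos (m := m) n).ne']
  · intro j hj
    exact fourierCoeff_eq_zero hm (integrable_dirichletBlock hm j)
      (stronglyMeasurable_filtration_of_forall fun x y h => dirichletBlock_congr hm j.lt_succ_self h)
      (M_mono (Finset.mem_range.1 hj))

/-- Subadditivity of `t ↦ t^p` bounds every partial tail by a series independent of `k`, so the
maximal function costs nothing. The case `n = 0` also gives membership in `H_p`. -/
theorem hpNorm_lacunaryMartingale_sub_le (hm : ∀ k, 2 ≤ m k) {p : ℝ} (hp0 : 0 < p) (hp1 : p < 1)
    (n : ℕ) :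
    hpNorm m p (fun k x => lacunaryMartingale m k x - lacunaryMartingale m (min k n) x) ≤
      (∑' j : ℕ, ((2 : ℝ≥0∞) ^ (p - 1)) ^ j) ^ (1 / p) * (M m n : ℝ≥0∞) ^ (-(1 / p - 1)) := by
  have h1 : ∀ x, maximalFunction
      (fun k x => lacunaryMartingale m k x - lacunaryMartingale m (min k n) x) x ^ p ≤
      ∑' j, (interval m (n + j) 0).indicator (fun _ => (M m (n + j) : ℝ≥0∞) ^ p) x := by
    intro x
    rw [← ENNReal.le_rpow_inv_iff hp0]
    refine iSup_le fun k => ?_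
    rw [ENNReal.le_rpow_inv_iff hp0]
    rcases le_total k n with h | h
    · simp [min_eq_left h, hp0]
    · obtain ⟨l, rfl⟩ := Nat.exists_eq_add_of_le h
      simp only [min_eq_right h]
      rw [lacunaryMartingale, lacunaryMartingale, Finset.sum_range_add,
        add_sub_cancel_left]
      refine (rpow_enorm_sum_le hp0 hp1.le _ _).trans ?_
      refine le_trans (Finset.sum_le_sum fun j _ => ?_) (ENNReal.sum_le_tsum (Finset.range l))
      exact enorm_dirichletBlock_rpow_le hm hp0 (n + j) x
  have h2 := (lintegral_mono h1).trans (lintegral_tsum_indicator_interval _ (0 : Gm m) _).le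
  have h3 := ENNReal.rpow_le_rpow (h2.trans (tsum_M_rpow_mul_inv_le hm hp1 n))
    (z := 1 / p) (by positivity)
  rw [hpNorm]
  refine h3.trans (le_of_eq ?_)
  rw [ENNReal.mul_rpow_of_nonneg _ _ (by positivity), ← ENNReal.rpow_mul, mul_comm,
    show (p - 1) * (1 / p) = -(1 / p - 1) by field_simp; ring]

theorem memHp_lacunaryMartingale (hm : ∀ k, 2 ≤ m k) {p : ℝ} (hp0 : 0 < p) (hp1 : p < 1) :
    MemHp m p (lacunaryMartingale m) := by
  refine ⟨martingale_lacunaryMartingale hm, ?_⟩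
  have h1 := hpNorm_lacunaryMartingale_sub_le hm hp0 hp1 0
  simp only [Nat.min_zero, M_zero, Nat.cast_one, ENNReal.one_rpow, mul_one] at h1
  have h2 : (fun k x => lacunaryMartingale m k x - lacunaryMartingale m 0 x) =
      lacunaryMartingale m := by
    ext k x; simp [lacunaryMartingale]
  rw [h2] at h1
  exact h1.trans_lt (ENNReal.rpow_lt_top_of_nonneg (by positivity) (tsum_two_rpow_lt_top hp1).ne)

theorem modulus_lacunaryMartingale_le (hm : ∀ k, 2 ≤ m k) {p : ℝ} (hp0 : 0 < p) (hp1 : p < 1)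
    (n : ℕ) : modulus m p (lacunaryMartingale m) n ≤
      (∑' j : ℕ, ((2 : ℝ≥0∞) ^ (p - 1)) ^ j) ^ (1 / p) * (M m n : ℝ≥0∞) ^ (-(1 / p - 1)) := by
  rw [modulus_eq hm p (martingale_lacunaryMartingale hm)]
  exact hpNorm_lacunaryMartingale_sub_le hm hp0 hp1 n

/-- Convergence would place `S_k f` and `S_{k+1} f` close to `F` at a common point, although they
differ there by the unimodular `ψ_k`. -/
theorem not_tendsto_weakLpNorm_of_martCoeff (hm : ∀ k, 2 ≤ m k) {p : ℝ} (hp0 : 0 < p)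
    {f : ℕ → Gm m → ℂ} (hf : ∃ᶠ k in atTop, martCoeff m f k = 1) (F : Gm m → ℂ) :
    ¬ Tendsto (fun k => weakLpNorm m p fun x => martPartialSum m f k x - F x) atTop (𝓝 0) := by
  intro h
  have h3 : ((1 / 3 : ℝ≥0) : ℝ≥0∞) ≠ 0 := by simp
  -- The value `1/3` serves twice: two exceptional sets of measure below `1/3` do not cover the
  -- group, and two errors of at most `1/3` do not add up to `1`.
  have hε : 0 < ((1 / 3 : ℝ≥0) : ℝ≥0∞) * ((1 / 3 : ℝ≥0) : ℝ≥0∞) ^ (1 / p) :=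
    ENNReal.mul_pos h3 (ENNReal.rpow_pos (pos_iff_ne_zero.2 h3) (by simp)).ne'
  have hsmall : ∀ᶠ k in atTop,
      haar m {x | ((1 / 3 : ℝ≥0) : ℝ≥0∞) < ‖martPartialSum m f k x - F x‖ₑ} <
        ((1 / 3 : ℝ≥0) : ℝ≥0∞) := by
    filter_upwards [h.eventually_lt_const hε] with k hk
    have h4 := (le_iSup₂ (f := fun (t : ℝ≥0) (_ : 0 < t) => (t : ℝ≥0∞) *
      haar m {x | (t : ℝ≥0∞) < ‖martPartialSum m f k x - F x‖ₑ} ^ (1 / p)) (1 / 3)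
        (by positivity)).trans_lt hk
    rw [ENNReal.mul_lt_mul_iff_right h3 (by simp)] at h4
    exact (ENNReal.rpow_lt_rpow_iff (by positivity)).1 h4
  obtain ⟨k, hk, hk1, hk2⟩ :=
    (hf.and_eventually (hsmall.and ((tendsto_add_atTop_nat 1).eventually hsmall))).exists
  set A := {x | ((1 / 3 : ℝ≥0) : ℝ≥0∞) < ‖martPartialSum m f k x - F x‖ₑ}
  set B := {x | ((1 / 3 : ℝ≥0) : ℝ≥0∞) < ‖martPartialSum m f (k + 1) x - F x‖ₑ}
  have hAB : haar m (A ∪ B) < 1 := by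
    refine ((measure_union_le _ _).trans_lt (ENNReal.add_lt_add hk1 hk2)).trans ?_
    rw [← ENNReal.coe_add, ← ENNReal.coe_one, ENNReal.coe_lt_coe, ← NNReal.coe_lt_coe]
    push_cast
    norm_num
  obtain ⟨x, hx⟩ : ∃ x, x ∉ A ∪ B := by
    by_contra! hall
    rw [Set.eq_univ_of_forall hall, measure_univ] at hAB
    exact lt_irrefl _ hAB
  simp only [Set.mem_union, not_or, A, B, Set.mem_ofPred_eq, not_lt] at hx
  have h5 : psi m k x =
      (martPartialSum m f (k + 1) x - F x) - (martPartialSum m f k x - F x) := by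
    rw [martPartialSum, martPartialSum, Finset.sum_range_succ, hk]
    ring
  have h6 : ‖martPartialSum m f k x - F x‖ ≤ 1 / 3 := by
    have := hx.1
    rw [enorm_eq_nnnorm, ENNReal.coe_le_coe, ← NNReal.coe_le_coe] at this
    simpa using this
  have h7 : ‖martPartialSum m f (k + 1) x - F x‖ ≤ 1 / 3 := by
    have := hx.2
    rw [enorm_eq_nnnorm, ENNReal.coe_le_coe, ← NNReal.coe_le_coe] at this
    simpa using this
  have h8 := norm_sub_le (martPartialSum m f (k + 1) x - F x) (martPartialSum m f k x - F x)
  rw [← h5, norm_psi hm] at h8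
  linarith

end Lacunary

/-! ### Assembly of the two claims -/

section Main

variable {m : ℕ → ℕ} [∀ k, NeZero (m k)]

theorem ofReal_M_rpow {a : ℝ} (n : ℕ) :
    ENNReal.ofReal ((M m n : ℝ) ^ a) = (M m n : ℝ≥0∞) ^ a := by
  rw [← ENNReal.ofReal_rpow_of_pos (by exact_mod_cast M_pos n), ENNReal.ofReal_natCast]

theorem exists_limit_and_tendsto_weakLpNorm (hm : ∀ k, 2 ≤ m k) {p : ℝ} (hp0 : 0 < p)
    (hp1 : p < 1) (hbdd : BddAbove (Set.range m)) {f : ℕ → Gm m → ℂ} (hf : MemHp m p f)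
    (hmod : Tendsto (fun n => modulus m p f n * (M m n : ℝ≥0∞) ^ (1 / p - 1)) atTop (𝓝 0)) :
    ∃ F, MemWeakLp m p F ∧ IsLimitFunction m f F ∧
      Tendsto (fun k => weakLpNorm m p fun x => martPartialSum m f k x - F x) atTop (𝓝 0) := by
  obtain ⟨b, hb⟩ := hbdd
  have hb : ∀ k, m k ≤ b := fun k => hb ⟨k, rfl⟩
  have hp : 0 < 1 / p - 1 := by
    rw [sub_pos, one_lt_div hp0]; exact hp1
  -- The weight `M_n^{1/p-1}` is at least `1`, so the modulus itself tends to zero, which yields the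
  -- limit function.
  have h1 : Tendsto (modulus m p f) atTop (𝓝 0) := by
    refine tendsto_of_tendsto_of_tendsto_of_le_of_le tendsto_const_nhds hmod
      (fun _ => zero_le) fun n => le_mul_of_one_le_right zero_le ?_
    exact ENNReal.one_le_rpow (by exact_mod_cast M_pos (m := m) n) hp
  obtain ⟨F, hF, hlim⟩ := exists_isLimitFunction hm hp0 hf h1
  refine ⟨F, hF, hlim, ENNReal.tendsto_nhds_zero.2 fun ε hε => ?_⟩
  set C := (((b : ℝ≥0∞) ^ p * ∑' j : ℕ, ((2 : ℝ≥0∞) ^ (p - 1)) ^ j) * (b : ℝ≥0∞) ^ (1 - p) + 1) ^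
    (1 / p)
  have hC : C ≠ ∞ := by
    refine ENNReal.rpow_ne_top_of_nonneg (by positivity) (ENNReal.add_ne_top.2 ⟨?_, by simp⟩)
    refine ENNReal.mul_ne_top (ENNReal.mul_ne_top ?_ (tsum_two_rpow_lt_top hp1).ne) ?_ <;>
      exact ENNReal.rpow_ne_top_of_nonneg (by linarith) (by simp)
  have h2 := ENNReal.Tendsto.const_mul hmod (Or.inr hC)
  rw [mul_zero] at h2
  obtain ⟨N, hN⟩ := eventually_atTop.1 (ENNReal.tendsto_nhds_zero.1 h2 ε hε)
  filter_upwards [eventually_ge_atTop (M m N)] with k hk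
  obtain ⟨n, hn, hnk, hkn⟩ := exists_M_le_lt hm hk
  exact (weakLpNorm_martPartialSum_sub_le hm hp0 hp1 hb hf.1 hF.1 hlim hnk hkn.le).trans (hN n hn)

end Main
end Vilenkin

theorem theorem3 (m : ℕ → ℕ) (hm : ∀ k, 2 ≤ m k) (p : ℝ) (hp0 : 0 < p) (hp1 : p < 1) :
    (BddAbove (Set.range m) →
      ∀ f : ℕ → Vilenkin.Gm m → ℂ, Vilenkin.MemHp m p f →
        Tendsto (fun n : ℕ => Vilenkin.modulus m p f n *
          ENNReal.ofReal ((Vilenkin.M m n : ℝ) ^ (1 / p - 1))) atTop (𝓝 0) →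
        ∃ F : Vilenkin.Gm m → ℂ, Vilenkin.MemWeakLp m p F ∧ Vilenkin.IsLimitFunction m f F ∧
          Tendsto (fun k : ℕ => Vilenkin.weakLpNorm m p
            (fun x => Vilenkin.martPartialSum m f k x - F x)) atTop (𝓝 0)) ∧
    (∃ f : ℕ → Vilenkin.Gm m → ℂ, Vilenkin.MemHp m p f ∧
      (∃ C : ℝ≥0, ∀ᶠ n : ℕ in atTop, Vilenkin.modulus m p f (2 * n) ≤
        C * ENNReal.ofReal ((Vilenkin.M m (2 * n) : ℝ) ^ (-(1 / p - 1)))) ∧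
      ∃ F : Vilenkin.Gm m → ℂ, Vilenkin.MemWeakLp m p F ∧ Vilenkin.IsLimitFunction m f F ∧
        ¬ Tendsto (fun k : ℕ => Vilenkin.weakLpNorm m p
            (fun x => Vilenkin.martPartialSum m f k x - F x)) atTop (𝓝 0)) := by
  have : ∀ k, NeZero (m k) := fun k => ⟨by have := hm k; omega⟩
  simp only [Vilenkin.ofReal_M_rpow]
  refine ⟨fun hbdd f hf hmod =>
    Vilenkin.exists_limit_and_tendsto_weakLpNorm hm hp0 hp1 hbdd hf hmod,
    Vilenkin.lacunaryMartingale m, Vilenkin.memHp_lacunaryMartingale hm hp0 hp1, ?_, ?_⟩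
  all_goals
    have hC : (∑' j : ℕ, ((2 : ℝ≥0∞) ^ (p - 1)) ^ j) ^ (1 / p) ≠ ∞ :=
      ENNReal.rpow_ne_top_of_nonneg (by positivity) (Vilenkin.tsum_two_rpow_lt_top hp1).ne
    have hmod := Vilenkin.modulus_lacunaryMartingale_le hm hp0 hp1
  · refine ⟨((∑' j : ℕ, ((2 : ℝ≥0∞) ^ (p - 1)) ^ j) ^ (1 / p)).toNNReal,
      Eventually.of_forall fun n => ?_⟩
    rw [ENNReal.coe_toNNReal hC]
    exact hmod (2 * n)
  · have ha : -(1 / p - 1) < 0 := by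
      rw [neg_lt_zero, sub_pos, one_lt_div hp0]; exact hp1
    -- The modulus bound holds at every index, not only the even ones, and tends to zero, so the
    -- limit function exists as in (a).
    have h0 := ENNReal.Tendsto.const_mul (Vilenkin.tendsto_M_rpow hm ha) (Or.inr hC)
    rw [mul_zero] at h0
    obtain ⟨F, hF, hlim⟩ := Vilenkin.exists_isLimitFunction hm hp0
      (Vilenkin.memHp_lacunaryMartingale hm hp0 hp1)
      (tendsto_of_tendsto_of_tendsto_of_le_of_le tendsto_const_nhds h0 (fun _ => zero_le) hmod)
    refine ⟨F, hF, hlim, Vilenkin.not_tendsto_weakLpNorm_of_martCoeff hm hp0 ?_ F⟩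
    refine frequently_atTop.2 fun n => ⟨Vilenkin.M m n, ?_,
      Vilenkin.martCoeff_lacunaryMartingale hm n⟩
    exact Nat.lt_two_pow_self.le.trans (Vilenkin.two_pow_le_M hm n)
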